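/- The cofinality $\mathrm{cof}(P)$ of a partially ordered set $P$ is the minimal cardinality of a set $C\subseteq P$ such that every $p\in P$ satisfies $p\le c$ for some $c\in C$. For a topological space $X$, let $K(X)$ be the family of compact subsets of $X$, ordered by inclusion; let $d(X)$ be the density of $X$, that is, the minimal cardinality of a dense subset of $X$; and for $x\in X$ let $\mathrm{ld}(x)$ be the local density of $x$, that is, the minimal density of a neighborhood of $x$. Let $\mathfrak{d}=\mathrm{cof}(\mathbb{N}^{\mathbb{N}},\le)$, where $\le$ is the pointwise order, and for a cardinal number $\kappa$ let $[\kappa]^{\aleph_0}$ be the family of countably infinite subsets of $\kappa$, ordered by inclusion (if $\kappa$ is finite, this family is empty and its cofinality is $0$). Theorem. Let $X$ be a complete metric space. 1. If $X$ is noncompact and locally compact, then $\mathrm{cof}(K(X))=d(X)$. 2. If $X$ is not locally compact, then $$\mathrm{cof}(K(X))=d(X)\cdot\mathfrak{d}\cdot\sup_{x\in X}\mathrm{cof}\bigl([\mathrm{ld}(x)]^{\aleph_0}\bigr).$$ -/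

import Mathlib

open scoped Topology Cardinal

noncomputable section

namespace CofCompact

/-- The density of a topological space: the minimal cardinality of a dense subset. -/
def density (X : Type*) [TopologicalSpace X] : Cardinal :=
  ⨅ s : {s : Set X // Dense s}, #s.1

/-- The local density of a point: the minimal density of a neighborhood of the point
(the neighborhood carries the subspace topology). -/
def localDensity {X : Type*} [TopologicalSpace X] (x : X) : Cardinal :=
  ⨅ U : {U : Set X // U ∈ 𝓝 x}, density U.1

/-- The family of all countably infinite subsets of the cardinal number `κ`
(represented by a type of cardinality `κ`), ordered by inclusion. -/
abbrev CtblInfSubsets (κ : Cardinal) : Type _ :=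
  {s : Set κ.out // s.Countable ∧ s.Infinite}

/-- The dominating number: the cofinality of the functions `ℕ → ℕ` ordered pointwise. -/
def dominatingNumber : Cardinal.{0} :=
  Order.cof (ℕ → ℕ)

end CofCompact

end

universe u v

namespace CofCompact

open Set Filter Metric TopologicalSpace Cardinal Topology

/-! Lower bounds: compact sets are separable, so a cofinal family yields a dense set of no larger
size. The other factors embed by Tukey reductions into compact sets converging to a point `x`:
finite blocks of lengths given by `f : ℕ → ℕ`, or sequences coding a countable subset of the local
density. Upper bound: `cof_compacts_le_density_mul` glues local dominating families by finite
unions. Near `x`, a compact set is captured by a countable set of centers and a function bounding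
how many centers serve at each scale; completeness makes the resulting `netSet` compact. -/

/-- A Tukey reduction from `α` to `β` bounds the cofinality of `α` by that of `β`. -/
theorem lift_cof_le_of_tukey {α : Type u} {β : Type v} [Preorder α] [Preorder β] (f : α → β)
    (g : β → α) (h : ∀ a b, f a ≤ b → a ≤ g b) :
    Cardinal.lift.{v} (Order.cof α) ≤ Cardinal.lift.{u} (Order.cof β) := by
  rw [Order.le_lift_cof_iff]
  intro s hs
  refine (Cardinal.lift_le.2 (Order.cof_le (s := g '' s) fun a ↦ ?_)).trans mk_image_le_lift
  obtain ⟨b, hb, hab⟩ := hs (f a)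
  exact ⟨g b, mem_image_of_mem g hb, h a b hab⟩

/-! ### Density, local density and compactness -/

section Density

variable {X : Type u} [TopologicalSpace X]

theorem density_le {s : Set X} (hs : Dense s) : density X ≤ #s :=
  ciInf_le' (fun s : {s : Set X // Dense s} ↦ #s.1) ⟨s, hs⟩

variable (X) in
theorem exists_dense_mk_eq_density : ∃ s : Set X, Dense s ∧ #s = density X := by
  have : Nonempty {s : Set X // Dense s} := ⟨⟨univ, dense_univ⟩⟩
  obtain ⟨s, hs⟩ := ciInf_mem fun s : {s : Set X // Dense s} ↦ #s.1
  exact ⟨s.1, s.2, hs⟩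

theorem localDensity_le {x : X} {U : Set X} (hU : U ∈ 𝓝 x) : localDensity x ≤ density U :=
  ciInf_le' (fun U : {U : Set X // U ∈ 𝓝 x} ↦ density U.1) ⟨U, hU⟩

theorem exists_density_eq_localDensity (x : X) : ∃ U ∈ 𝓝 x, density U = localDensity x := by
  have : Nonempty {U : Set X // U ∈ 𝓝 x} := ⟨⟨univ, univ_mem⟩⟩
  obtain ⟨U, hU⟩ := ciInf_mem fun U : {U : Set X // U ∈ 𝓝 x} ↦ density U.1
  exact ⟨U.1, U.2, hU⟩

theorem exists_subset_closure_mk_eq_localDensity (x : X) :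
    ∃ D : Set X, closure D ∈ 𝓝 x ∧ #D = localDensity x := by
  obtain ⟨U, hU, hd⟩ := exists_density_eq_localDensity x
  obtain ⟨s, hs, hsd⟩ := exists_dense_mk_eq_density U
  refine ⟨(↑) '' s, mem_of_superset hU fun y hy ↦ ?_, ?_⟩
  · exact closure_subtype.1 (hs ⟨y, hy⟩)
  · rw [mk_image_eq Subtype.val_injective, hsd, hd]

theorem localDensity_le_mk_of_dense {E : Set X} (hE : Dense E) {x : X} {U : Set X}
    (hU : U ∈ 𝓝 x) (hUo : IsOpen U) : localDensity x ≤ #(E ∩ U : Set X) := by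
  refine (localDensity_le hU).trans ((density_le
    (hE.preimage hUo.isOpenEmbedding_subtypeVal.isOpenMap)).trans ?_)
  rw [← mk_image_eq (Subtype.val_injective (p := (· ∈ U)))]
  refine mk_le_mk_of_subset ?_
  rintro _ ⟨y, hy, rfl⟩
  exact ⟨hy, y.2⟩

theorem aleph0_le_density [T1Space X] (hX : ¬ CompactSpace X) : ℵ₀ ≤ density X := by
  obtain ⟨s, hs, hsd⟩ := exists_dense_mk_eq_density X
  by_contra h
  rw [← hsd, not_le, lt_aleph0_iff_set_finite] at h
  have : s = Set.univ := by rw [← h.isClosed.closure_eq, hs.closure_eq]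
  exact hX ⟨this ▸ h.isCompact⟩

theorem exists_isCompact_mem_nhds_of_localDensity_lt [T1Space X] {x : X}
    (h : localDensity x < ℵ₀) : ∃ K ∈ 𝓝 x, IsCompact K := by
  obtain ⟨D, hD, hc⟩ := exists_subset_closure_mk_eq_localDensity x
  rw [← hc, lt_aleph0_iff_set_finite] at h
  exact ⟨D, h.isClosed.closure_eq ▸ hD, h.isCompact⟩

theorem exists_forall_not_isCompact_of_mem_nhds [R1Space X] (hX : ¬ LocallyCompactSpace X) :
    ∃ x : X, ∀ K ∈ 𝓝 x, ¬ IsCompact K := by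
  by_contra! h
  have : WeaklyLocallyCompactSpace X := ⟨fun x ↦ (h x).imp fun _ h ↦ h.symm⟩
  exact hX inferInstance

theorem aleph0_le_cof_compacts (hX : ¬ CompactSpace X) : ℵ₀ ≤ Order.cof (Compacts X) := by
  refine Order.le_cof_iff.2 fun S hS ↦ ?_
  by_contra h
  rw [not_le, lt_aleph0_iff_set_finite] at h
  refine hX ⟨(h.isCompact_biUnion fun K _ ↦ K.isCompact).of_isClosed_subset isClosed_univ ?_⟩
  intro x _
  obtain ⟨K, hK, hxK⟩ := hS ⟨{x}, isCompact_singleton⟩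
  exact mem_biUnion hK (hxK rfl)

end Density

/-! ### Lower bounds for the cofinality -/

section LowerBounds

variable {X : Type u} [MetricSpace X]

theorem density_le_cof_compacts (hX : ¬ CompactSpace X) : density X ≤ Order.cof (Compacts X) := by
  obtain ⟨S, hS, hSc⟩ := Order.exists_cof_eq (Compacts X)
  have hinf := aleph0_le_cof_compacts hX
  have hsep : ∀ K : Compacts X, ∃ c : Set X, c.Countable ∧ (K : Set X) ⊆ closure c :=
    fun K ↦ K.isCompact.isSeparable
  choose c hc hKc using hsep
  have hd : Dense (⋃ K : S, c K) := fun x ↦ by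
    obtain ⟨K, hK, hxK⟩ := hS ⟨{x}, isCompact_singleton⟩
    exact closure_mono (subset_iUnion (fun K : S ↦ c K) ⟨K, hK⟩) (hKc K (hxK rfl))
  calc density X ≤ #(⋃ K : S, c K) := density_le hd
    _ ≤ #S * ⨆ K : S, #(c K) := mk_iUnion_le _
    _ ≤ #S * ℵ₀ := by gcongr; exact ciSup_le' fun K ↦ (hc K).le_aleph0
    _ = Order.cof (Compacts X) := by rw [hSc, mul_aleph0_eq hinf]

/-- A sequence in `s` with no subsequence converging in `s` can visit a compact set only finitely
often. -/
theorem exists_seq_finite_preimage_of_not_isCompact {s : Set X} (hs : IsClosed s)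
    (hc : ¬ IsCompact s) :
    ∃ v : ℕ → X, (∀ k, v k ∈ s) ∧ ∀ K, IsCompact K → {k | v k ∈ K}.Finite := by
  rw [isCompact_iff_isSeqCompact, IsSeqCompact] at hc
  push Not at hc
  obtain ⟨v, hv, hlim⟩ := hc
  refine ⟨v, hv, fun K hK ↦ ?_⟩
  by_contra hinf
  obtain ⟨φ, hφ, hφK⟩ := extraction_of_frequently_atTop (Nat.frequently_atTop_iff_infinite.2 hinf)
  obtain ⟨a, -, ψ, hψ, ha⟩ := hK.tendsto_subseq hφK
  exact hlim a (hs.mem_of_tendsto ha (Eventually.of_forall fun _ ↦ hv _)) (φ ∘ ψ) (hφ.comp hψ) ha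

theorem lift_dominatingNumber_le_cof_compacts (hX : ¬ LocallyCompactSpace X) :
    Cardinal.lift.{u} dominatingNumber ≤ Order.cof (Compacts X) := by
  obtain ⟨x, hx⟩ := exists_forall_not_isCompact_of_mem_nhds hX
  have hseq : ∀ n : ℕ, ∃ v : ℕ → X, (∀ k, v k ∈ closedBall x (1 / (n + 1 : ℝ))) ∧
      ∀ K, IsCompact K → {k | v k ∈ K}.Finite := fun n ↦
    exists_seq_finite_preimage_of_not_isCompact isClosed_closedBall
      (hx _ (closedBall_mem_nhds x Nat.one_div_pos_of_nat))
  choose v hv hfin using hseq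
  have hcpt (f : ℕ → ℕ) :
      IsCompact (insert x (range fun p : Σ n, Fin (f n + 1) ↦ v p.1 p.2)) := by
    refine Tendsto.isCompact_insert_range_of_cofinite (tendsto_iff_dist_tendsto_zero.2 ?_)
    -- Each block is finite, so all but finitely many points lie in blocks of large index, hence
    -- close to `x`.
    have h1 : Tendsto (fun p : Σ n, Fin (f n + 1) ↦ p.1) cofinite cofinite :=
      Tendsto.cofinite_of_finite_preimage_singleton fun n ↦
        (finite_range (Sigma.mk n)).subset fun p hp ↦ by
          obtain ⟨m, k⟩ := p
          obtain rfl : m = n := hp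
          exact mem_range_self k
    rw [Nat.cofinite_eq_atTop] at h1
    exact squeeze_zero (fun _ ↦ dist_nonneg) (fun p ↦ hv p.1 p.2)
      (tendsto_one_div_add_atTop_nhds_zero_nat.comp h1)
  have hbdd (K : Compacts X) (n : ℕ) : ∃ m, ∀ k, v n k ∈ K → k ≤ m := by
    obtain ⟨m, hm⟩ := (hfin n K K.isCompact).bddAbove
    exact ⟨m, fun k hk ↦ hm hk⟩
  choose g hg using hbdd
  have := lift_cof_le_of_tukey (fun f : ℕ → ℕ ↦ (⟨_, hcpt f⟩ : Compacts X)) g fun f K hfK n ↦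
    hg K n (f n) (SetLike.coe_subset_coe.2 hfK (Or.inr ⟨⟨n, Fin.last (f n)⟩, rfl⟩))
  simpa [dominatingNumber] using this

theorem exists_maximal_separated {r : ℝ} (hr : 0 < r) :
    ∃ A : Set X, A.Pairwise (r ≤ dist · ·) ∧ ∀ x, ∃ a ∈ A, dist x a < r := by
  obtain ⟨A, hA⟩ := zorn_subset {A : Set X | A.Pairwise (r ≤ dist · ·)} fun c hc hchain ↦
    ⟨⋃₀ c, (pairwise_sUnion hchain.directedOn).2 fun s hs ↦ hc hs,
      fun s hs ↦ subset_sUnion_of_mem hs⟩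
  refine ⟨A, hA.prop, fun x ↦ ?_⟩
  by_contra! h
  have hx : x ∈ A := hA.le_of_ge (y := insert x A)
    (hA.prop.insert fun a ha _ ↦ ⟨h a ha, dist_comm x a ▸ h a ha⟩)
    (subset_insert x A) (mem_insert x A)
  exact (h x hx).not_gt (by simpa using hr)

theorem finite_inter_of_pairwise_le_dist {r : ℝ} (hr : 0 < r) {A K : Set X}
    (hA : A.Pairwise (r ≤ dist · ·)) (hK : IsCompact K) : (A ∩ K).Finite := by
  obtain ⟨t, -, ht, hKt⟩ := hK.finite_cover_balls (half_pos hr)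
  refine (ht.biUnion (t := fun y ↦ A ∩ ball y (r / 2)) fun y _ ↦ ?_).subset fun z hz ↦ ?_
  · refine Set.Subsingleton.finite fun a ha b hb ↦ ?_
    by_contra hne
    have h1 := hA ha.1 hb.1 hne
    have h2 := dist_triangle_right a b y
    have h3 := mem_ball.1 ha.2
    have h4 := mem_ball.1 hb.2
    linarith
  · obtain ⟨y, hy, hzy⟩ := mem_iUnion₂.1 (hKt hz.2)
    exact mem_biUnion hy ⟨hz.1, hzy⟩

variable (X) in
/-- A metric space has a dense subset that meets every compact set in a countable set. -/
theorem exists_dense_countable_inter_isCompact :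
    ∃ E : Set X, Dense E ∧ ∀ K, IsCompact K → (E ∩ K).Countable := by
  -- Each separated set meets a compact set finitely; maximality at all scales makes the union
  -- dense.
  choose A hA hcov using fun n : ℕ ↦
    exists_maximal_separated (X := X) (r := 1 / (n + 1 : ℝ)) Nat.one_div_pos_of_nat
  refine ⟨⋃ n, A n, fun x ↦ Metric.mem_closure_iff.2 fun ε hε ↦ ?_, fun K hK ↦ ?_⟩
  · obtain ⟨n, hn⟩ := exists_nat_one_div_lt hε
    obtain ⟨a, ha, hxa⟩ := hcov n x
    exact ⟨a, mem_iUnion.2 ⟨n, ha⟩, hxa.trans hn⟩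
  · rw [iUnion_inter]
    exact countable_iUnion fun n ↦
      (finite_inter_of_pairwise_le_dist Nat.one_div_pos_of_nat (hA n) hK).countable

theorem exists_ctblInfSubsets_superset {κ : Cardinal.{u}} (hκ : ℵ₀ ≤ κ) {s : Set κ.out}
    (hs : s.Countable) : ∃ t : CtblInfSubsets κ, s ⊆ t.1 := by
  have : Infinite κ.out := by rwa [infinite_iff, mk_out]
  refine ⟨⟨s ∪ range (Infinite.natEmbedding κ.out), hs.union (countable_range _), ?_⟩,
    subset_union_left⟩
  exact (infinite_range_of_injective (Infinite.natEmbedding κ.out).injective).mono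
    subset_union_right

theorem isEmpty_ctblInfSubsets {κ : Cardinal.{u}} (hκ : κ < ℵ₀) : IsEmpty (CtblInfSubsets κ) := by
  have : Finite κ.out := by rwa [← mk_lt_aleph0_iff, mk_out]
  exact ⟨fun s ↦ s.2.2 (toFinite _)⟩

theorem cof_ctblInfSubsets_localDensity_le (x : X) :
    Order.cof (CtblInfSubsets (localDensity x)) ≤ Order.cof (Compacts X) := by
  rcases lt_or_ge (localDensity x) ℵ₀ with hκ | hκ
  · have := isEmpty_ctblInfSubsets hκ
    simp
  obtain ⟨E, hE, hEK⟩ := exists_dense_countable_inter_isCompact X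
  -- The cardinal is copied into every ball about `x`; taking the `n`-th listed element from the
  -- `n`-th copy forces convergence to `x`.
  have hemb (n : ℕ) :
      Nonempty ((localDensity x).out ↪ (E ∩ ball x (1 / (n + 1 : ℝ)) : Set X)) := by
    rw [← Cardinal.le_def, mk_out]
    exact localDensity_le_mk_of_dense hE (ball_mem_nhds x Nat.one_div_pos_of_nat) isOpen_ball
  let ψ := fun n ↦ (hemb n).some
  have henum (s : CtblInfSubsets (localDensity x)) :
      ∃ e : ℕ → (localDensity x).out, s.1 = range e :=
    s.2.1.exists_eq_range s.2.2.nonempty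
  choose e he using henum
  have hcpt (s) : IsCompact (insert x (range fun n ↦ (ψ n (e s n) : X))) := by
    refine Tendsto.isCompact_insert_range (tendsto_iff_dist_tendsto_zero.2 ?_)
    exact squeeze_zero (fun _ ↦ dist_nonneg) (fun n ↦ (ψ n (e s n)).2.2.le)
      tendsto_one_div_add_atTop_nhds_zero_nat
  have hctbl (K : Compacts X) : (⋃ n, {a | (ψ n a : X) ∈ K}).Countable := by
    refine countable_iUnion fun n ↦ ?_
    have hinj : Function.Injective fun a ↦ (ψ n a : X) :=
      Subtype.val_injective.comp (ψ n).injective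
    refine ((hEK K K.isCompact).preimage_of_injOn hinj.injOn).mono fun a ha ↦ ?_
    exact ⟨(ψ n a).2.1, ha⟩
  choose g hg using fun K ↦ exists_ctblInfSubsets_superset hκ (hctbl K)
  simpa using lift_cof_le_of_tukey (fun s ↦ (⟨_, hcpt s⟩ : Compacts X)) g fun s K hsK ↦ by
    change s.1 ⊆ (g K).1
    rw [he s]
    rintro _ ⟨n, rfl⟩
    have hmem : (ψ n (e s n) : X) ∈ K :=
      SetLike.coe_subset_coe.2 hsK (mem_insert_of_mem x (mem_range_self n))
    exact hg K (mem_iUnion.2 ⟨n, hmem⟩)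

end LowerBounds

/-! ### Upper bounds for the cofinality -/

section UpperBounds

variable {X : Type u} [MetricSpace X]

theorem exists_closedBall_subset_of_dense {D : Set X} (hD : Dense D) {x : X} {U : Set X}
    (hU : U ∈ 𝓝 x) :
    ∃ p : D × ℕ, x ∈ ball (p.1 : X) (1 / (p.2 + 1 : ℝ)) ∧
      closedBall (p.1 : X) (1 / (p.2 + 1 : ℝ)) ⊆ U := by
  obtain ⟨ε, hε, hεU⟩ := Metric.nhds_basis_closedBall.mem_iff.1 hU
  obtain ⟨n, hn⟩ := exists_nat_one_div_lt (half_pos hε)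
  obtain ⟨d, hd, hxd⟩ := Metric.mem_closure_iff.1 (hD x) (1 / (n + 1 : ℝ)) Nat.one_div_pos_of_nat
  refine ⟨(⟨d, hd⟩, n), hxd, (closedBall_subset_closedBall' ?_).trans hεU⟩
  rw [dist_comm]
  dsimp only
  linarith

/-- If every point has a neighborhood whose compact subsets are dominated by at most `μ` compact
sets, then `μ` times the density bounds the cofinality of the family of compact sets. -/
theorem cof_compacts_le_density_mul {μ : Cardinal.{u}} (hX : ℵ₀ ≤ density X) (hμ : μ ≠ 0)
    (h : ∀ x : X, ∃ U ∈ 𝓝 x, ∃ F : Set (Compacts X), #F ≤ μ ∧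
      ∀ K : Compacts X, (K : Set X) ⊆ U → ∃ L ∈ F, K ≤ L) :
    Order.cof (Compacts X) ≤ density X * μ := by
  classical
  choose U hU F hF hdom using h
  obtain ⟨D, hD, hDc⟩ := exists_dense_mk_eq_density X
  let B : D × ℕ → Set X := fun p ↦ closedBall (p.1 : X) (1 / (p.2 + 1 : ℝ))
  -- Indexing by balls with centers in `D`, not by all points of `X`, keeps the union of families
  -- small.
  let G : D × ℕ → Set (Compacts X) := fun p ↦
    if h : ∃ x, B p ⊆ U x then F h.choose else ∅
  have hG (p : D × ℕ) : #(G p) ≤ μ := by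
    by_cases h : ∃ x, B p ⊆ U x
    · simpa only [G, dif_pos h] using hF _
    · simp [G, dif_neg h]
  let T : Set (Compacts X) := ⋃ p, G p
  have hDμ : ℵ₀ ≤ density X * μ := hX.trans (le_mul_right hμ)
  have hT : #T ≤ density X * μ := calc
    #T ≤ #(D × ℕ) * ⨆ p, #(G p) := mk_iUnion_le _
    _ ≤ #(D × ℕ) * μ := by gcongr; exact ciSup_le' hG
    _ = density X * μ := by
      rw [mk_prod, mk_nat, lift_aleph0, lift_uzero, hDc, mul_aleph0_eq hX]
  have hcof : IsCofinal (range fun s : Finset T ↦ s.sup Subtype.val) := fun K ↦ by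
    have hloc (x : X) : ∃ p : D × ℕ, x ∈ ball (p.1 : X) (1 / (p.2 + 1 : ℝ)) ∧
        ∃ L ∈ T, (K : Set X) ∩ B p ⊆ L := by
      obtain ⟨p, hxp, hp⟩ := exists_closedBall_subset_of_dense hD (hU x)
      have hex : ∃ x, B p ⊆ U x := ⟨x, hp⟩
      obtain ⟨L, hL, hKL⟩ := hdom hex.choose ⟨K ∩ B p, K.isCompact.inter_right isClosed_closedBall⟩
        (inter_subset_right.trans hex.choose_spec)
      refine ⟨p, hxp, L, mem_iUnion.2 ⟨p, ?_⟩, hKL⟩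
      simpa only [G, dif_pos hex] using hL
    choose p hxp L hL hKL using hloc
    obtain ⟨t, -, ht⟩ := K.isCompact.elim_nhds_subcover _
      fun x _ ↦ isOpen_ball.mem_nhds (hxp x)
    refine ⟨_, ⟨t.image fun x ↦ ⟨L x, hL x⟩, rfl⟩, fun y hy ↦ ?_⟩
    obtain ⟨x, hx, hyx⟩ := mem_iUnion₂.1 (ht hy)
    exact SetLike.coe_subset_coe.2
      (Finset.le_sup (f := Subtype.val) (Finset.mem_image_of_mem (fun x ↦ (⟨L x, hL x⟩ : T)) hx))
      (hKL x ⟨hy, ball_subset_closedBall hyx⟩)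
  refine (Order.cof_le hcof).trans (mk_range_le.trans ?_)
  rcases finite_or_infinite T with hfin | hinf
  · exact (mk_le_aleph0 (α := Finset T)).trans hDμ
  · rwa [mk_finset_of_infinite]

/-- The set of all points that for each `n` are within `1 / (n + 1)` of one of the points
`e 0, …, e (f n)`. -/
def netSet (e : ℕ → X) (f : ℕ → ℕ) : Set X :=
  ⋂ n : ℕ, ⋃ k ∈ Iic (f n), closedBall (e k) (1 / (n + 1 : ℝ))

theorem isCompact_netSet [CompleteSpace X] (e : ℕ → X) (f : ℕ → ℕ) : IsCompact (netSet e f) := by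
  refine TotallyBounded.isCompact_of_isClosed ?_
    (isClosed_iInter fun n ↦ (finite_Iic (f n)).isClosed_biUnion fun k _ ↦ isClosed_closedBall)
  refine Metric.totallyBounded_iff.2 fun ε hε ↦ ?_
  obtain ⟨n, hn⟩ := exists_nat_one_div_lt hε
  refine ⟨e '' Iic (f n), (finite_Iic (f n)).image e, (iInter_subset _ n).trans ?_⟩
  rw [biUnion_image]
  exact iUnion₂_mono fun k _ ↦ closedBall_subset_ball hn

/-- Finite nets of `K` at all scales can be taken in `D`. A cofinal countable set contains all of
them, and a dominating function bounds their indices in its enumeration. -/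
theorem exists_compacts_dominating_closure [CompleteSpace X] {κ : Cardinal.{u}} (hκ : ℵ₀ ≤ κ)
    {D : Set X} (hD : #D = κ) :
    ∃ F : Set (Compacts X),
      #F ≤ Cardinal.lift.{u} dominatingNumber * Order.cof (CtblInfSubsets κ) ∧
      ∀ K : Compacts X, (K : Set X) ⊆ closure D → ∃ L ∈ F, K ≤ L := by
  obtain ⟨φ⟩ : Nonempty (κ.out ≃ D) := by rw [← Cardinal.eq, mk_out, hD]
  obtain ⟨C, hC, hCc⟩ := Order.exists_cof_eq (CtblInfSubsets κ)
  obtain ⟨G, hG, hGc⟩ := Order.exists_cof_eq (ℕ → ℕ)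
  choose e he using fun s : CtblInfSubsets κ ↦ s.2.1.exists_eq_range s.2.2.nonempty
  refine ⟨range fun q : G × C ↦ ⟨netSet (fun k ↦ (φ (e q.2 k) : X)) q.1, isCompact_netSet _ _⟩,
    mk_range_le.trans (by simp [dominatingNumber, hCc, ← hGc]), fun K hK ↦ ?_⟩
  have hnet (n : ℕ) : ∃ t : Set D, t.Finite ∧
      (K : Set X) ⊆ ⋃ a ∈ t, closedBall (a : X) (1 / (n + 1 : ℝ)) := by
    obtain ⟨t, ht⟩ := K.isCompact.elim_finite_subcover
      (fun a : D ↦ ball (a : X) (1 / (n + 1 : ℝ))) (fun _ ↦ isOpen_ball) fun x hx ↦ by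
        obtain ⟨a, ha, hxa⟩ := Metric.mem_closure_iff.1 (hK hx) _ (Nat.one_div_pos_of_nat (n := n))
        exact mem_iUnion.2 ⟨⟨a, ha⟩, hxa⟩
    exact ⟨t, t.finite_toSet, ht.trans (iUnion₂_mono fun _ _ ↦ ball_subset_closedBall)⟩
  choose t htf ht using hnet
  obtain ⟨s₀, hs₀⟩ := exists_ctblInfSubsets_superset hκ
    ((countable_iUnion fun n ↦ (htf n).countable).image φ.symm)
  obtain ⟨s, hs, hs₀s⟩ := hC s₀
  have hidx (a : D) (n : ℕ) (ha : a ∈ t n) : ∃ k, φ (e s k) = a := by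
    have : φ.symm a ∈ s.1 := hs₀s (hs₀ (mem_image_of_mem _ (mem_iUnion.2 ⟨n, ha⟩)))
    rw [he s] at this
    obtain ⟨k, hk⟩ := this
    exact ⟨k, by rw [hk, φ.apply_symm_apply]⟩
  have hbound (n : ℕ) : ∃ m, ∀ a ∈ t n, ∃ k ≤ m, φ (e s k) = a := by
    choose! k hk using fun a ↦ hidx a n
    obtain ⟨m, hm⟩ := ((htf n).image k).bddAbove
    exact ⟨m, fun a ha ↦ ⟨k a, hm (mem_image_of_mem k ha), hk a ha⟩⟩
  choose f₀ hf₀ using hbound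
  obtain ⟨f, hf, hf₀f⟩ := hG f₀
  refine ⟨_, ⟨(⟨f, hf⟩, ⟨s, hs⟩), rfl⟩, fun x hx ↦ mem_iInter.2 fun n ↦ ?_⟩
  obtain ⟨a, ha, hxa⟩ := mem_iUnion₂.1 (ht n hx)
  obtain ⟨k, hk, rfl⟩ := hf₀ n a ha
  exact mem_biUnion (show k ∈ Iic (f n) from hk.trans (hf₀f n)) hxa

end UpperBounds

theorem cof_compacts_of_locallyCompact {X : Type u} [MetricSpace X] [LocallyCompactSpace X]
    (hX : ¬ CompactSpace X) : Order.cof (Compacts X) = density X := by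
  refine le_antisymm ?_ (density_le_cof_compacts hX)
  rw [← mul_one (density X)]
  refine cof_compacts_le_density_mul (aleph0_le_density hX) one_ne_zero fun x ↦ ?_
  obtain ⟨K, hK, hxK⟩ := exists_compact_mem_nhds x
  exact ⟨K, hxK, {⟨K, hK⟩}, by simp, fun L hL ↦ ⟨_, rfl, hL⟩⟩

theorem cof_compacts_of_not_locallyCompact {X : Type u} [MetricSpace X] [CompleteSpace X]
    (hX : ¬ LocallyCompactSpace X) :
    Order.cof (Compacts X) = density X * Cardinal.lift.{u} dominatingNumber *
      ⨆ x : X, Order.cof (CtblInfSubsets (localDensity x)) := by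
  have hXc : ¬ CompactSpace X := fun _ ↦ hX inferInstance
  have hinf := aleph0_le_cof_compacts hXc
  refine le_antisymm ?_ ?_
  · have hle (x : X) : Order.cof (CtblInfSubsets (localDensity x)) ≤
        ⨆ x : X, Order.cof (CtblInfSubsets (localDensity x)) :=
      le_ciSup Cardinal.bddAbove_of_small x
    have hd : Cardinal.lift.{u} dominatingNumber ≠ 0 := by simp [dominatingNumber]
    -- A point without compact neighborhoods has infinite local density, so its term is nonzero.
    have hsup : (⨆ x : X, Order.cof (CtblInfSubsets (localDensity x))) ≠ 0 := by
      obtain ⟨x, hx⟩ := exists_forall_not_isCompact_of_mem_nhds hX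
      have hκ : ℵ₀ ≤ localDensity x := by
        by_contra! h
        obtain ⟨K, hK, hKc⟩ := exists_isCompact_mem_nhds_of_localDensity_lt h
        exact hx K hK hKc
      obtain ⟨s, -⟩ := exists_ctblInfSubsets_superset hκ countable_empty
      have : Nonempty (CtblInfSubsets (localDensity x)) := ⟨s⟩
      exact fun h0 ↦ Order.cof_ne_zero (nonpos_iff_eq_zero.1 ((hle x).trans h0.le))
    rw [mul_assoc]
    refine cof_compacts_le_density_mul (aleph0_le_density hXc) (mul_ne_zero hd hsup) fun x ↦ ?_
    -- At finite local density the term of `x` is zero, but a single compact neighborhood suffices.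
    rcases lt_or_ge (localDensity x) ℵ₀ with hκ | hκ
    · obtain ⟨K, hK, hKc⟩ := exists_isCompact_mem_nhds_of_localDensity_lt hκ
      refine ⟨K, hK, {⟨K, hKc⟩}, ?_, fun L hL ↦ ⟨_, rfl, hL⟩⟩
      rw [mk_singleton, Cardinal.one_le_iff_ne_zero]
      exact mul_ne_zero hd hsup
    · obtain ⟨D, hD, hDc⟩ := exists_subset_closure_mk_eq_localDensity x
      obtain ⟨F, hF, hdom⟩ := exists_compacts_dominating_closure hκ hDc
      exact ⟨closure D, hD, F, hF.trans (by gcongr; exact hle x), hdom⟩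
  · exact mul_le_of_le hinf (mul_le_of_le hinf (density_le_cof_compacts hXc)
      (lift_dominatingNumber_le_cof_compacts hX))
      (ciSup_le' cof_ctblInfSubsets_localDensity_le)

end CofCompact

theorem mainTheorem4 {X : Type*} [MetricSpace X] [CompleteSpace X] :
    (¬ CompactSpace X → LocallyCompactSpace X →
      Order.cof (TopologicalSpace.Compacts X) = CofCompact.density X) ∧
    (¬ LocallyCompactSpace X →
      Order.cof (TopologicalSpace.Compacts X) =
        CofCompact.density X * Cardinal.lift CofCompact.dominatingNumber *
          ⨆ x : X, Order.cof (CofCompact.CtblInfSubsets (CofCompact.localDensity x))) := by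
  exact ⟨fun h _ ↦ CofCompact.cof_compacts_of_locallyCompact h,
    CofCompact.cof_compacts_of_not_locallyCompact⟩
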